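/- Let $M\ge 1$ be an integer and $q\in(1,M+1]$. A $q$-expansion of a real number $x$ is a sequence $(x_i)_{i\ge1}\in\{0,1,\dots,M\}^{\infty}$ with $x=\sum_{i\ge 1}x_i q^{-i}$. Let $\mathcal U_q$ be the set of all $x\in[0,M/(q-1)]$ that have exactly one $q$-expansion, and let $\mathbf U_q\subseteq\{0,1,\dots,M\}^{\infty}$ be the set of the $q$-expansions of the elements of $\mathcal U_q$. Let $B_n(\mathbf U_q)$ be the set of words of length $n$ that occur in sequences of $\mathbf U_q$. Then the topological entropy $h(\mathbf U_q)=\lim_{n\to\infty}\frac1n\log\#B_n(\mathbf U_q)$ exists, the box dimension of $\mathcal U_q$ exists (that is, its lower and upper box dimensions coincide), and $$\dim_B\mathcal U_q=\dim_H\mathcal U_q=\frac{h(\mathbf U_q)}{\log q}.$$ Here $\log$ is the logarithm in base $M+1$, and the lower and upper box dimensions of a set $X\subset\mathbb R$ are the lower and upper limits, as $\delta\to0^+$, of $\log N_\delta(X)/(-\log\delta)$, where $N_\delta(X)$ is the least number of closed intervals of length $\delta$ needed to cover $X$. -/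

import Mathlib

open Filter Topology
open scoped NNReal ENNReal

noncomputable section

namespace Univoque

/-- The value in base `q` of a digit sequence over the alphabet `{0, …, M}`. The digit with
(one-based) index `i + 1` is `c i`, so the value is `∑_{i ≥ 1} x_i / q ^ i`. -/
def value (M : ℕ) (q : ℝ) (c : ℕ → Fin (M + 1)) : ℝ :=
  ∑' i : ℕ, ((c i : ℕ) : ℝ) / q ^ (i + 1)

/-- The univoque set: all `x ∈ [0, M / (q - 1)]` with exactly one expansion in base `q` over the
alphabet `{0, …, M}`. -/
def univoqueSet (M : ℕ) (q : ℝ) : Set ℝ :=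
  {x | x ∈ Set.Icc (0 : ℝ) ((M : ℝ) / (q - 1)) ∧ ∃! c : ℕ → Fin (M + 1), value M q c = x}

/-- The set of expansions of the elements of the univoque set. -/
def univoqueSeq (M : ℕ) (q : ℝ) : Set (ℕ → Fin (M + 1)) :=
  value M q ⁻¹' univoqueSet M q

/-- The words of length `n` that occur (anywhere) in a sequence of `X`. -/
def subwords {M : ℕ} (X : Set (ℕ → Fin (M + 1))) (n : ℕ) : Set (Fin n → Fin (M + 1)) :=
  {w | ∃ c ∈ X, ∃ k : ℕ, ∀ i : Fin n, w i = c (k + i)}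

/-- The sequence `log #B_n(X) / n`, with logarithm in base `M + 1`. -/
def entropySeq {M : ℕ} (X : Set (ℕ → Fin (M + 1))) (n : ℕ) : ℝ :=
  Real.logb ((M : ℝ) + 1) ((subwords X n).ncard : ℝ) / (n : ℝ)

/-- The topological entropy `lim log #B_n(X) / n`, with logarithm in base `M + 1`
(meaningful when the limit exists). -/
def entropy {M : ℕ} (X : Set (ℕ → Fin (M + 1))) : ℝ :=
  limUnder atTop (entropySeq X)

/-- The least number of closed intervals of length `δ` that cover `X` (`⊤` if no finite number
suffices): a closed interval of length `δ` is a closed ball of radius `δ / 2` in `ℝ`. -/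
def coverNum (X : Set ℝ) (δ : ℝ) : ℕ∞ :=
  Metric.externalCoveringNumber (δ / 2).toNNReal X

/-- The ratio `log N_δ(X) / (- log δ)`, as an extended real number. -/
def boxRatio (X : Set ℝ) (δ : ℝ) : EReal :=
  ENNReal.log (coverNum X δ : ℝ≥0∞) / ((-Real.log δ : ℝ) : EReal)

/-- The lower box dimension. -/
def lowerBoxDim (X : Set ℝ) : EReal :=
  liminf (boxRatio X) (𝓝[>] (0 : ℝ))

/-- The upper box dimension. -/
def upperBoxDim (X : Set ℝ) : EReal :=
  limsup (boxRatio X) (𝓝[>] (0 : ℝ))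

end Univoque

end

/-!
Write `C = M / (q - 1)`, and let `X` be the set of univoque sequences. Since `q ≤ M + 1`, every
number in `[0, C]` has an expansion (`exists_value_eq`). Hence in a univoque sequence the tail
after a digit `< M` has value `< 1`, and the tail after a digit `> 0` has value `> C - 1`.
Weakening both inequalities defines a compact shift-invariant set `weakSeq M q ⊇ X`, and the values
of its elements outside `X` are countably many, because some tail takes one of the two boundary
values (`countable_value_weakSeq_diff`). So the univoque set and the set of values of `weakSeq` have
the same Hausdorff dimension.

Let `q < M + 1`. Weakly univoque sequences that first differ at place `n` have values at distance at
least `(C - 1) / q ^ (n + 1)` (`le_abs_value_sub_value`), so a cover by sets of small diameter is in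
effect a cover by cylinders. For `s` above the Hausdorff dimension this yields finitely many words
`w`, one of which starts each sequence, with `∑ q ^ (-s * |w|) ≤ 1`. Cutting off such words one
after the other shows that the number of words of length `n` is `O(q ^ (s * n))`
(`exists_ncard_prefixes_le`), so that `h / log q ≤ s`. For `q = M + 1` the univoque set is `[0, 1]`
up to a countable set, and `h / log q ≤ 1` holds trivially.

Conversely, one interval per cylinder gives upper box dimension at most `h / log q`, where the
entropy `h` exists by Fekete's lemma. As the Hausdorff dimension never exceeds the lower box
dimension (`dimH_le_lowerBoxDim`), all the quantities coincide.
-/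

namespace Univoque

variable {M : ℕ} {q : ℝ}

/-! ### Values of digit sequences -/

/-- The sequence `c` with its first `k` digits removed. -/
def shift (k : ℕ) (c : ℕ → Fin (M + 1)) : ℕ → Fin (M + 1) := fun i => c (k + i)

/-- The sequence that agrees with `c` in the first `k` places and continues with `e`. -/
def splice (k : ℕ) (c e : ℕ → Fin (M + 1)) : ℕ → Fin (M + 1) :=
  fun i => if i < k then c i else e (i - k)

lemma shift_splice (k : ℕ) (c e : ℕ → Fin (M + 1)) : shift k (splice k c e) = e := by
  funext i; simp [shift, splice]

lemma splice_of_lt {k i : ℕ} (h : i < k) (c e : ℕ → Fin (M + 1)) : splice k c e i = c i := by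
  simp [splice, h]

lemma shift_shift (j k : ℕ) (c : ℕ → Fin (M + 1)) : shift j (shift k c) = shift (k + j) c := by
  funext i; simp [shift, add_assoc]

lemma digit_le (d : Fin (M + 1)) : ((d : ℕ) : ℝ) ≤ M := by
  exact_mod_cast Nat.le_of_lt_succ d.isLt

lemma hasSum_geometric_tail (hq : 1 < q) :
    HasSum (fun i : ℕ => (M : ℝ) / q ^ (i + 1)) ((M : ℝ) / (q - 1)) := by
  have h0 : 0 < q := by linarith
  have h := (hasSum_geometric_of_lt_one (inv_nonneg.2 h0.le) (inv_lt_one_of_one_lt₀ hq)).mul_left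
    ((M : ℝ) / q)
  have hsum : (M : ℝ) / q * (1 - q⁻¹)⁻¹ = (M : ℝ) / (q - 1) := by
    rw [div_mul_eq_mul_div, ← div_eq_mul_inv, div_div, sub_mul, inv_mul_cancel₀ h0.ne', one_mul]
  rw [hsum] at h
  refine h.congr_fun fun i => ?_
  rw [pow_succ, inv_pow, mul_comm (q ^ i), ← div_div, div_eq_mul_inv _ (q ^ i)]

lemma term_le (hq : 1 < q) (c : ℕ → Fin (M + 1)) (i : ℕ) :
    ((c i : ℕ) : ℝ) / q ^ (i + 1) ≤ (M : ℝ) / q ^ (i + 1) := by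
  have h0 : 0 < q := by linarith
  exact div_le_div_of_nonneg_right (digit_le _) (by positivity)

lemma term_nonneg (hq : 1 < q) (c : ℕ → Fin (M + 1)) (i : ℕ) :
    0 ≤ ((c i : ℕ) : ℝ) / q ^ (i + 1) := by
  have h0 : 0 < q := by linarith
  positivity

lemma summable_value (hq : 1 < q) (c : ℕ → Fin (M + 1)) :
    Summable fun i : ℕ => ((c i : ℕ) : ℝ) / q ^ (i + 1) :=
  Summable.of_nonneg_of_le (term_nonneg hq c) (term_le hq c) (hasSum_geometric_tail hq).summable

lemma value_nonneg (hq : 1 < q) (c : ℕ → Fin (M + 1)) : 0 ≤ value M q c :=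
  tsum_nonneg (term_nonneg hq c)

lemma value_le (hq : 1 < q) (c : ℕ → Fin (M + 1)) : value M q c ≤ (M : ℝ) / (q - 1) :=
  (hasSum_geometric_tail hq).tsum_eq ▸
    (summable_value hq c).tsum_le_tsum (term_le hq c) (hasSum_geometric_tail hq).summable

lemma value_split (hq : 1 < q) (n : ℕ) (c : ℕ → Fin (M + 1)) :
    value M q c = ∑ i ∈ Finset.range n, ((c i : ℕ) : ℝ) / q ^ (i + 1) +
      value M q (shift n c) / q ^ n := by
  have h0 : 0 < q := by linarith
  rw [value, ← (summable_value hq c).sum_add_tsum_nat_add n, value, ← tsum_div_const]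
  congr 1
  refine tsum_congr fun i => ?_
  rw [shift, add_comm n i, div_div]
  congr 1
  ring

lemma value_split_succ (hq : 1 < q) (n : ℕ) (c : ℕ → Fin (M + 1)) :
    value M q c = ∑ i ∈ Finset.range n, ((c i : ℕ) : ℝ) / q ^ (i + 1) +
      ((c n : ℕ) + value M q (shift (n + 1) c)) / q ^ (n + 1) := by
  rw [value_split hq (n + 1), Finset.sum_range_succ, add_div, add_assoc]

/-- Two sequences that share their first `n` digits differ in value by the difference of what
follows. -/
lemma value_sub_value (hq : 1 < q) {n : ℕ} {c e : ℕ → Fin (M + 1)} (h : ∀ i < n, c i = e i) :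
    value M q c - value M q e =
      (((c n : ℕ) : ℝ) - (e n : ℕ) +
        (value M q (shift (n + 1) c) - value M q (shift (n + 1) e))) / q ^ (n + 1) := by
  rw [value_split_succ hq n c, value_split_succ hq n e,
    Finset.sum_congr rfl fun i hi => by rw [h i (Finset.mem_range.1 hi)]]
  ring

lemma continuous_value (hq : 1 < q) : Continuous (value M q) := by
  refine continuous_tsum (u := fun i : ℕ => (M : ℝ) / q ^ (i + 1)) (fun i => ?_)
    (hasSum_geometric_tail hq).summable fun i c => ?_
  · exact (continuous_of_discreteTopology (f := fun d : Fin (M + 1) => ((d : ℕ) : ℝ) /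
      q ^ (i + 1))).comp (continuous_apply i)
  · rw [Real.norm_of_nonneg (term_nonneg hq c i)]
    exact term_le hq c i

lemma continuous_shift (k : ℕ) : Continuous (shift (M := M) k) :=
  continuous_pi fun i => continuous_apply (k + i)

/-! ### Existence and uniqueness of expansions -/

/-- One step of the greedy algorithm: since `q ≤ M + 1`, every remainder `x ∈ [0, M / (q - 1)]`
admits a digit that keeps the next remainder in the same interval. -/
lemma exists_digit (hq : 1 < q) (hqM : q ≤ (M : ℝ) + 1) {x : ℝ}
    (hx : x ∈ Set.Icc (0 : ℝ) ((M : ℝ) / (q - 1))) :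
    ∃ d : Fin (M + 1), q * x - (d : ℕ) ∈ Set.Icc (0 : ℝ) ((M : ℝ) / (q - 1)) := by
  have h1 : 0 < q - 1 := by linarith
  have h0 : 0 ≤ q * x := mul_nonneg (by linarith) hx.1
  rcases le_or_gt (M : ℝ) (q * x) with h | h
  · refine ⟨Fin.last M, by simpa using h, ?_⟩
    have h2 := hx.2
    rw [le_div_iff₀ h1] at h2 ⊢
    simp only [Fin.val_last]
    nlinarith
  · have hf : ⌊q * x⌋₊ < M + 1 := by
      have : ⌊q * x⌋₊ < M := (Nat.floor_lt h0).2 h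
      omega
    refine ⟨⟨⌊q * x⌋₊, hf⟩, sub_nonneg.2 (Nat.floor_le h0), ?_⟩
    have h2 := Nat.lt_floor_add_one (q * x)
    have h3 : 1 ≤ (M : ℝ) / (q - 1) := by rw [le_div_iff₀ h1]; linarith
    simp only
    linarith

lemma exists_value_eq (hq : 1 < q) (hqM : q ≤ (M : ℝ) + 1) {x : ℝ}
    (hx : x ∈ Set.Icc (0 : ℝ) ((M : ℝ) / (q - 1))) :
    ∃ c : ℕ → Fin (M + 1), value M q c = x := by
  have h0 : 0 < q := by linarith
  choose d hd using fun y : Set.Icc (0 : ℝ) ((M : ℝ) / (q - 1)) => exists_digit hq hqM y.2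
  let T : Set.Icc (0 : ℝ) ((M : ℝ) / (q - 1)) → Set.Icc (0 : ℝ) ((M : ℝ) / (q - 1)) :=
    fun y => ⟨q * y - (d y : ℕ), hd y⟩
  let r : ℕ → Set.Icc (0 : ℝ) ((M : ℝ) / (q - 1)) := fun n => T^[n] ⟨x, hx⟩
  have hr : ∀ n, (r (n + 1) : ℝ) = q * r n - (d (r n) : ℕ) := fun n => by
    simp only [r, Function.iterate_succ_apply', T]
  have hsum : ∀ n, ∑ i ∈ Finset.range n, ((d (r i) : ℕ) : ℝ) / q ^ (i + 1) =
      x - (r n : ℝ) / q ^ n := by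
    intro n
    induction n with
    | zero => simp [r]
    | succ n ih =>
      rw [Finset.sum_range_succ, ih, hr]
      field_simp
      ring
  refine ⟨fun n => d (r n), HasSum.tsum_eq ?_⟩
  refine (hasSum_iff_tendsto_nat_of_nonneg (term_nonneg hq fun n => d (r n)) x).2 ?_
  have hlim : Tendsto (fun n => (r n : ℝ) / q ^ n) atTop (𝓝 0) := by
    refine squeeze_zero (fun n => div_nonneg (r n).2.1 (by positivity))
      (fun n => div_le_div_of_nonneg_right (r n).2.2 (by positivity)) ?_
    exact tendsto_const_nhds.div_atTop (tendsto_pow_atTop_atTop_of_one_lt hq)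
  simpa only [hsum, sub_zero] using hlim.const_sub x

/-- A sequence is univoque if and only if no other sequence has the same value. -/
lemma mem_univoqueSeq (hq : 1 < q) {c : ℕ → Fin (M + 1)} :
    c ∈ univoqueSeq M q ↔ ∀ e, value M q e = value M q c → e = c := by
  constructor
  · rintro ⟨-, d, -, hd⟩ e he
    rw [hd e he, hd c rfl]
  · exact fun h => ⟨⟨value_nonneg hq c, value_le hq c⟩, c, rfl, h⟩

lemma shift_mem_univoqueSeq (hq : 1 < q) {c : ℕ → Fin (M + 1)} (hc : c ∈ univoqueSeq M q)
    (k : ℕ) : shift k c ∈ univoqueSeq M q := by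
  rw [mem_univoqueSeq hq] at hc ⊢
  intro e he
  rw [← hc (splice k c e) ?_, shift_splice]
  rw [value_split hq k, value_split hq k c, shift_splice, he,
    Finset.sum_congr rfl fun i hi => by rw [splice_of_lt (Finset.mem_range.1 hi)]]

lemma const_zero_mem_univoqueSeq (hq : 1 < q) : (fun _ => 0) ∈ univoqueSeq M q := by
  have h0 : 0 < q := by linarith
  rw [mem_univoqueSeq hq]
  intro e he
  have hz : value M q (fun _ => 0) = 0 := by simp [value]
  rw [hz] at he
  have hs : HasSum (fun i : ℕ => ((e i : ℕ) : ℝ) / q ^ (i + 1)) (value M q e) :=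
    (summable_value hq e).hasSum
  rw [he] at hs
  have := (hasSum_zero_iff_of_nonneg (term_nonneg hq e)).1 hs
  funext i
  have hi := congrFun this i
  simp only [Pi.zero_apply, div_eq_zero_iff, Nat.cast_eq_zero] at hi
  rcases hi with hi | hi
  · exact Fin.ext hi
  · exact absurd hi (by positivity)

/-- If the digit `c n` could be changed to `d` with the tail adjusted accordingly, then `c` would
have a second expansion. -/
lemma tail_notMem_Icc (hq : 1 < q) (hqM : q ≤ (M : ℝ) + 1) {c : ℕ → Fin (M + 1)}
    (hc : c ∈ univoqueSeq M q) {n : ℕ} {d : Fin (M + 1)} (hd : d ≠ c n) :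
    ((c n : ℕ) : ℝ) - (d : ℕ) + value M q (shift (n + 1) c) ∉
      Set.Icc (0 : ℝ) ((M : ℝ) / (q - 1)) := by
  intro h
  obtain ⟨e, he⟩ := exists_value_eq hq hqM h
  rw [mem_univoqueSeq hq] at hc
  let c' := splice (n + 1) (Function.update c n d) e
  have hn : c' n = d := by simp [c', splice]
  have hlt : ∀ i < n, c' i = c i := fun i hi => by
    simp [c', splice, hi.trans (Nat.lt_succ_self n), hi.ne]
  have := value_sub_value hq hlt
  rw [hn, shift_splice, he] at this
  refine hd ?_
  rw [← hn, hc c' ?_]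
  rw [← sub_eq_zero, this]
  ring

/-! ### The closed shift of weakly univoque sequences -/

/-- The sequences whose tails satisfy the non-strict form of the inequalities that characterize
univoque sequences: after a digit that can be increased the tail has value at most `1`, and after
a digit that can be decreased it has value at least `M / (q - 1) - 1`. Unlike the set of univoque
sequences, this set is closed. -/
def weakSeq (M : ℕ) (q : ℝ) : Set (ℕ → Fin (M + 1)) :=
  {c | ∀ n, ((c n : ℕ) < M → value M q (shift (n + 1) c) ≤ 1) ∧
    (0 < (c n : ℕ) → (M : ℝ) / (q - 1) - 1 ≤ value M q (shift (n + 1) c))}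

lemma shift_mem_weakSeq {c : ℕ → Fin (M + 1)} (hc : c ∈ weakSeq M q) (k : ℕ) :
    shift k c ∈ weakSeq M q := by
  intro n
  rw [shift_shift]
  exact hc (k + n)

lemma univoqueSeq_subset_weakSeq (hq : 1 < q) (hqM : q ≤ (M : ℝ) + 1) :
    univoqueSeq M q ⊆ weakSeq M q := by
  intro c hc n
  have hv0 := value_nonneg hq (shift (n + 1) c)
  have hv1 := value_le hq (shift (n + 1) c)
  constructor
  · intro h
    by_contra! hv
    refine tail_notMem_Icc hq hqM hc (n := n) (d := ⟨c n + 1, by omega⟩)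
      (fun h => by simpa using congrArg Fin.val h) ⟨?_, ?_⟩ <;> push_cast <;> linarith
  · intro h
    by_contra! hv
    refine tail_notMem_Icc hq hqM hc (n := n) (d := ⟨c n - 1, by omega⟩)
      (fun h => by have := congrArg Fin.val h; simp at this; omega) ⟨?_, ?_⟩ <;>
      push_cast [Nat.cast_sub (show 1 ≤ (c n : ℕ) from h)] <;> linarith

lemma isCompact_weakSeq (hq : 1 < q) : IsCompact (weakSeq M q) := by
  refine IsClosed.isCompact ?_
  have hv : ∀ n, Continuous fun c : ℕ → Fin (M + 1) => value M q (shift (n + 1) c) :=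
    fun n => (continuous_value hq).comp (continuous_shift _)
  have hdig : ∀ (n : ℕ) (p : Fin (M + 1) → Prop), IsClosed {c : ℕ → Fin (M + 1) | p (c n)} :=
    fun n p => (isClosed_discrete {d | p d}).preimage (continuous_apply n)
  simp only [weakSeq, Set.ofPred_forall, Set.ofPred_and, imp_iff_not_or, Set.ofPred_or]
  exact isClosed_iInter fun n =>
    ((hdig n fun d => ¬ (d : ℕ) < M).union (isClosed_le (hv n) continuous_const)).inter
      ((hdig n fun d => ¬ 0 < (d : ℕ)).union (isClosed_le continuous_const (hv n)))

/-- A weakly univoque sequence none of whose tails attains a boundary value is univoque: at the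
first place where another expansion of the same number differs, the tail would have to have value
at least `1` or at most `M / (q - 1) - 1`. -/
lemma mem_univoqueSeq_of_mem_weakSeq (hq : 1 < q) {c : ℕ → Fin (M + 1)} (hc : c ∈ weakSeq M q)
    (hne : ∀ n, value M q (shift n c) ≠ 1 ∧ value M q (shift n c) ≠ (M : ℝ) / (q - 1) - 1) :
    c ∈ univoqueSeq M q := by
  have h0 : 0 < q := by linarith
  rw [mem_univoqueSeq hq]
  intro e he
  by_contra hec
  obtain ⟨k, hk⟩ := Function.ne_iff.1 hec
  let n := Nat.find (⟨k, hk⟩ : ∃ k, e k ≠ c k)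
  have hn : e n ≠ c n := Nat.find_spec (⟨k, hk⟩ : ∃ k, e k ≠ c k)
  have hlt : ∀ i < n, e i = c i := fun i hi =>
    not_not.1 (Nat.find_min (⟨k, hk⟩ : ∃ k, e k ≠ c k) hi)
  have hsub := value_sub_value hq hlt
  rw [he, sub_self, eq_comm, div_eq_zero_iff, or_iff_left (by positivity)] at hsub
  have hv0 := value_nonneg hq (shift (n + 1) e)
  have hv1 := value_le hq (shift (n + 1) e)
  have hen := (e n).isLt
  rcases lt_or_gt_of_ne (fun h => hn (Fin.ext h) : (e n : ℕ) ≠ c n) with h | h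
  · have h' : ((e n : ℕ) : ℝ) + 1 ≤ (c n : ℕ) := by exact_mod_cast h
    exact (hne (n + 1)).2 (le_antisymm (by linarith) ((hc n).2 (by omega)))
  · have h' : ((c n : ℕ) : ℝ) + 1 ≤ (e n : ℕ) := by exact_mod_cast h
    exact (hne (n + 1)).1 (le_antisymm ((hc n).1 (by omega)) (by linarith))

lemma countable_value_weakSeq_diff (hq : 1 < q) :
    (value M q '' weakSeq M q \ univoqueSet M q).Countable := by
  let f : (Σ n : ℕ, Fin n → Fin (M + 1)) × Bool → ℝ := fun w =>
    ∑ i : Fin w.1.1, ((w.1.2 i : ℕ) : ℝ) / q ^ ((i : ℕ) + 1) +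
      (if w.2 then 1 else (M : ℝ) / (q - 1) - 1) / q ^ w.1.1
  refine (Set.countable_range f).mono ?_
  rintro x ⟨⟨c, hc, rfl⟩, hx⟩
  have : ¬ ∀ n, value M q (shift n c) ≠ 1 ∧ value M q (shift n c) ≠ (M : ℝ) / (q - 1) - 1 :=
    fun h => hx (mem_univoqueSeq_of_mem_weakSeq hq hc h)
  push Not at this
  obtain ⟨n, hn⟩ := this
  by_cases h1 : value M q (shift n c) = 1
  · refine ⟨(⟨n, fun i => c i⟩, true), ?_⟩
    simp only [f, if_true]
    rw [value_split hq n, h1, Finset.sum_range]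
  · refine ⟨(⟨n, fun i => c i⟩, false), ?_⟩
    simp only [f, Bool.false_eq_true, if_false]
    rw [value_split hq n, hn h1, Finset.sum_range]

lemma univoqueSet_subset_image (hq : 1 < q) (hqM : q ≤ (M : ℝ) + 1) :
    univoqueSet M q ⊆ value M q '' weakSeq M q := by
  intro x hx
  obtain ⟨c, hc, -⟩ := hx.2
  exact ⟨c, univoqueSeq_subset_weakSeq hq hqM (show value M q c ∈ _ from hc ▸ hx), hc⟩

lemma dimH_univoqueSet (hq : 1 < q) (hqM : q ≤ (M : ℝ) + 1) :
    dimH (univoqueSet M q) = dimH (value M q '' weakSeq M q) := by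
  rw [← Set.union_sdiff_cancel (univoqueSet_subset_image hq hqM), dimH_union,
    dimH_countable (countable_value_weakSeq_diff hq), max_eq_left zero_le]

/-- Weakly univoque sequences that first differ at place `n` have values at distance at least
`(M / (q - 1) - 1) / q ^ (n + 1)`, a positive multiple of `q ^ (-n)` as soon as `q < M + 1`. -/
lemma le_abs_value_sub_value (hq : 1 < q) {c e : ℕ → Fin (M + 1)} (hc : c ∈ weakSeq M q)
    (he : e ∈ weakSeq M q) {n : ℕ} (hlt : ∀ i < n, c i = e i) (hn : c n ≠ e n) :
    ((M : ℝ) / (q - 1) - 1) / q ^ (n + 1) ≤ |value M q c - value M q e| := by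
  have h0 : 0 < q := by linarith
  rw [value_sub_value hq hlt, abs_div, abs_of_pos (pow_pos h0 _)]
  refine div_le_div_of_nonneg_right ?_ (pow_pos h0 _).le
  have hcn := (c n).isLt
  have hen := (e n).isLt
  rcases lt_or_gt_of_ne (fun h => hn (Fin.ext h) : (c n : ℕ) ≠ e n) with h | h
  · have h' : ((c n : ℕ) : ℝ) + 1 ≤ (e n : ℕ) := by exact_mod_cast h
    have h1 := (hc n).1 (by omega)
    have h2 := (he n).2 (by omega)
    rw [le_abs]
    right
    linarith
  · have h' : ((e n : ℕ) : ℝ) + 1 ≤ (c n : ℕ) := by exact_mod_cast h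
    have h1 := (he n).1 (by omega)
    have h2 := (hc n).2 (by omega)
    rw [le_abs]
    left
    linarith

/-! ### Counting words -/

/-- The initial words of length `n` of the sequences in `X`. -/
def prefixes (X : Set (ℕ → Fin (M + 1))) (n : ℕ) : Set (Fin n → Fin (M + 1)) :=
  (fun c i => c i) '' X

lemma prefixes_mono {X Y : Set (ℕ → Fin (M + 1))} (h : X ⊆ Y) (n : ℕ) :
    prefixes X n ⊆ prefixes Y n := Set.image_mono h

lemma subwords_eq_prefixes {X : Set (ℕ → Fin (M + 1))} (hX : ∀ c ∈ X, ∀ k, shift k c ∈ X)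
    (n : ℕ) : subwords X n = prefixes X n := by
  ext w
  constructor
  · rintro ⟨c, hc, k, hw⟩
    exact ⟨shift k c, hX c hc k, funext fun i => (hw i).symm⟩
  · rintro ⟨c, hc, rfl⟩
    exact ⟨c, hc, 0, fun i => by simp⟩

lemma ncard_prefixes_le_pow (X : Set (ℕ → Fin (M + 1))) (n : ℕ) :
    (prefixes X n).ncard ≤ (M + 1) ^ n := by
  refine (Set.ncard_le_card _).trans ?_
  simp

lemma one_le_ncard_prefixes {X : Set (ℕ → Fin (M + 1))} (hX : X.Nonempty) (n : ℕ) :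
    1 ≤ (prefixes X n).ncard :=
  (Set.ncard_pos (Set.toFinite _)).2 (hX.image _)

lemma ncard_prefixes_add_le {X : Set (ℕ → Fin (M + 1))} (hX : ∀ c ∈ X, ∀ k, shift k c ∈ X)
    (m n : ℕ) : (prefixes X (m + n)).ncard ≤ (prefixes X m).ncard * (prefixes X n).ncard := by
  rw [← Set.ncard_prod]
  refine Set.ncard_le_ncard_of_injOn
    (fun w => (fun i => w (Fin.castAdd n i), fun i => w (Fin.natAdd m i))) ?_ ?_ (Set.toFinite _)
  · rintro _ ⟨c, hc, rfl⟩
    exact ⟨⟨c, hc, rfl⟩, ⟨shift m c, hX c hc m, rfl⟩⟩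
  · intro v _ w _ h
    funext i
    refine Fin.addCases (fun j => ?_) (fun j => ?_) i
    · exact congrFun (congrArg Prod.fst h) j
    · exact congrFun (congrArg Prod.snd h) j

/-- The entropy of a nonempty shift-invariant set exists, by Fekete's lemma. -/
lemma tendsto_entropySeq {X : Set (ℕ → Fin (M + 1))} (hne : X.Nonempty)
    (hX : ∀ c ∈ X, ∀ k, shift k c ∈ X) :
    Tendsto (entropySeq X) atTop (𝓝 (entropy X)) := by
  have hM : (1 : ℝ) ≤ (M : ℝ) + 1 := by linarith [Nat.cast_nonneg (α := ℝ) M]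
  have hlog : 0 ≤ Real.log ((M : ℝ) + 1) := Real.log_nonneg hM
  have hpos : ∀ n, (1 : ℝ) ≤ (prefixes X n).ncard := fun n => by
    exact_mod_cast one_le_ncard_prefixes hne n
  let u : ℕ → ℝ := fun n => Real.logb ((M : ℝ) + 1) ((subwords X n).ncard : ℝ)
  have hu : Subadditive u := by
    intro m n
    simp only [u, Real.logb, subwords_eq_prefixes hX]
    rw [← add_div, ← Real.log_mul (by linarith [hpos m]) (by linarith [hpos n])]
    refine div_le_div_of_nonneg_right (Real.log_le_log (by linarith [hpos (m + n)]) ?_) hlog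
    exact_mod_cast ncard_prefixes_add_le hX m n
  have hbdd : BddBelow (Set.range fun n => u n / n) := by
    refine ⟨0, ?_⟩
    rintro _ ⟨n, rfl⟩
    simp only [u, Real.logb, subwords_eq_prefixes hX]
    exact div_nonneg (div_nonneg (Real.log_nonneg (hpos n)) hlog) (Nat.cast_nonneg n)
  have h : Tendsto (entropySeq X) atTop (𝓝 hu.lim) := hu.tendsto_lim hbdd
  rwa [entropy, h.limUnder_eq]

/-- If every sequence of a shift-invariant set starts with one of finitely many nonempty words
whose lengths satisfy the Kraft-type inequality `∑ a ^ (-length) ≤ 1`, then its number of words of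
length `n` is `O(a ^ n)`: cutting off the first such word gives a recursive inequality. -/
lemma exists_ncard_prefixes_le {ι : Type*} {X : Set (ℕ → Fin (M + 1))}
    (hX : ∀ c ∈ X, ∀ k, shift k c ∈ X) (F : Finset ι) (w : ι → ℕ → Fin (M + 1)) (len : ι → ℕ)
    (hlen : ∀ i ∈ F, 0 < len i) (hcov : ∀ c ∈ X, ∃ i ∈ F, ∀ j < len i, c j = w i j)
    {a : ℝ} (ha : 1 ≤ a) (hsum : ∑ i ∈ F, (a ^ len i)⁻¹ ≤ 1) :
    ∃ K : ℝ, 0 < K ∧ ∀ n, ((prefixes X n).ncard : ℝ) ≤ K * a ^ n := by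
  have hM : (1 : ℝ) ≤ (M : ℝ) + 1 := by linarith [Nat.cast_nonneg (α := ℝ) M]
  refine ⟨((M : ℝ) + 1) ^ F.sup len, by positivity, fun n => ?_⟩
  induction n using Nat.strong_induction_on with
  | _ n ih =>
    rcases lt_or_ge n (F.sup len) with hn | hn
    · calc ((prefixes X n).ncard : ℝ) ≤ ((M : ℝ) + 1) ^ n := by
            exact_mod_cast ncard_prefixes_le_pow X n
        _ ≤ ((M : ℝ) + 1) ^ F.sup len := pow_le_pow_right₀ hM hn.le
        _ ≤ ((M : ℝ) + 1) ^ F.sup len * a ^ n :=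
            le_mul_of_one_le_right (by positivity) (one_le_pow₀ ha)
    · have hle : ∀ i ∈ F, len i ≤ n := fun i hi => (Finset.le_sup hi).trans hn
      let Q : ι → Set (Fin n → Fin (M + 1)) := fun i =>
        prefixes {c ∈ X | ∀ j < len i, c j = w i j} n
      have hsub : prefixes X n ⊆ ⋃ i ∈ F, Q i := by
        rintro _ ⟨c, hc, rfl⟩
        obtain ⟨i, hi, hw⟩ := hcov c hc
        exact Set.mem_biUnion hi ⟨c, ⟨hc, hw⟩, rfl⟩
      have hQ : ∀ i ∈ F, (Q i).ncard ≤ (prefixes X (n - len i)).ncard := by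
        intro i hi
        have := hle i hi
        refine Set.ncard_le_ncard_of_injOn
          (fun v j => v ⟨len i + j, by have := j.isLt; omega⟩) ?_ ?_ (Set.toFinite _)
        · rintro _ ⟨c, ⟨hc, -⟩, rfl⟩
          exact ⟨shift (len i) c, hX c hc _, rfl⟩
        · rintro _ ⟨c, ⟨-, hcw⟩, rfl⟩ _ ⟨e, ⟨-, hew⟩, rfl⟩ h
          funext j
          rcases lt_or_ge (j : ℕ) (len i) with hj | hj
          · simp only [hcw j hj, hew j hj]
          · have := congrFun h ⟨j - len i, by have := j.isLt; omega⟩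
            simpa [Nat.add_sub_cancel' hj] using this
      calc ((prefixes X n).ncard : ℝ)
          ≤ ∑ i ∈ F, ((prefixes X (n - len i)).ncard : ℝ) := by
            have h1 := Set.ncard_le_ncard hsub (Set.toFinite _)
            have h2 := F.set_ncard_biUnion_le Q
            exact_mod_cast (h1.trans h2).trans (Finset.sum_le_sum hQ)
        _ ≤ ∑ i ∈ F, ((M : ℝ) + 1) ^ F.sup len * a ^ (n - len i) :=
            Finset.sum_le_sum fun i hi => ih _ (by have := hle i hi; have := hlen i hi; omega)
        _ = ((M : ℝ) + 1) ^ F.sup len * a ^ n * ∑ i ∈ F, (a ^ len i)⁻¹ := by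
            rw [Finset.mul_sum]
            refine Finset.sum_congr rfl fun i hi => ?_
            rw [pow_sub₀ a (by linarith) (hle i hi), mul_assoc]
        _ ≤ ((M : ℝ) + 1) ^ F.sup len * a ^ n :=
            mul_le_of_le_one_right (by positivity) hsum

lemma entropy_le_of_ncard_le {X : Set (ℕ → Fin (M + 1))} (hM : 1 ≤ M) (hne : X.Nonempty)
    (hX : ∀ c ∈ X, ∀ k, shift k c ∈ X) {a K : ℝ} (ha : 0 < a) (hK : 0 < K)
    (h : ∀ n, ((prefixes X n).ncard : ℝ) ≤ K * a ^ n) :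
    entropy X ≤ Real.logb ((M : ℝ) + 1) a := by
  have hM' : (1 : ℝ) < (M : ℝ) + 1 := by
    have : (1 : ℝ) ≤ M := by exact_mod_cast hM
    linarith
  have hlim : Tendsto (fun n : ℕ => Real.logb ((M : ℝ) + 1) K / n + Real.logb ((M : ℝ) + 1) a)
      atTop (𝓝 (0 + Real.logb ((M : ℝ) + 1) a)) :=
    (tendsto_const_div_atTop_nhds_zero_nat _).add_const _
  rw [zero_add] at hlim
  refine le_of_tendsto_of_tendsto (tendsto_entropySeq hne hX) hlim ?_
  filter_upwards [eventually_gt_atTop 0] with n hn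
  have hn' : (0 : ℝ) < n := by exact_mod_cast hn
  have h1 : (0 : ℝ) < (prefixes X n).ncard := by exact_mod_cast one_le_ncard_prefixes hne n
  rw [entropySeq, subwords_eq_prefixes hX, div_le_iff₀ hn', add_mul, div_mul_cancel₀ _ hn'.ne',
    mul_comm (Real.logb _ a), ← Real.logb_pow,
    ← Real.logb_mul hK.ne' (pow_pos ha n).ne']
  exact Real.logb_le_logb_of_le hM' h1 (h n)

/-! ### Lower bound for the Hausdorff dimension -/

/-- A set of zero `s`-dimensional Hausdorff measure has countable covers with arbitrarily small
`∑ η ^ s`, where `η` strictly bounds the distances within the covering sets. The strict bounds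
make all `η` positive even for covering sets that are single points. -/
lemma exists_cover_of_hausdorffMeasure_eq_zero {X : Type*} [MetricSpace X] [MeasurableSpace X]
    [BorelSpace X] {s : ℝ} (hs : 0 < s) {E : Set X}
    (hE : MeasureTheory.Measure.hausdorffMeasure s E = 0) {ε : ℝ} (hε : 0 < ε) :
    ∃ (t : ℕ → Set X) (η : ℕ → ℝ), E ⊆ ⋃ k, t k ∧ (∀ k, 0 < η k) ∧
      (∀ k, ∀ x ∈ t k, ∀ y ∈ t k, dist x y < η k) ∧
      ∀ F : Finset ℕ, ∑ k ∈ F, η k ^ s ≤ ε := by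
  have hε' : (0 : ℝ≥0∞) < ENNReal.ofReal (ε / 2) := ENNReal.ofReal_pos.2 (by linarith)
  have hlt : (⨅ (t : ℕ → Set X) (_ : E ⊆ ⋃ n, t n) (_ : ∀ n, Metric.ediam (t n) ≤ ⊤),
      ∑' n, ⨆ _ : (t n).Nonempty, Metric.ediam (t n) ^ s) < ENNReal.ofReal (ε / 2) := by
    refine lt_of_le_of_lt ?_ hε'
    rw [MeasureTheory.Measure.hausdorffMeasure_apply] at hE
    exact hE ▸ le_iSup₂ (f := fun (r : ℝ≥0∞) (_ : 0 < r) =>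
      ⨅ (t : ℕ → Set X) (_ : E ⊆ ⋃ n, t n) (_ : ∀ n, Metric.ediam (t n) ≤ r),
        ∑' n, ⨆ _ : (t n).Nonempty, Metric.ediam (t n) ^ s) ⊤ ENNReal.zero_lt_top
  simp only [iInf_lt_iff] at hlt
  obtain ⟨t, hcov, -, hsum⟩ := hlt
  have hterm : ∀ n, (⨆ _ : (t n).Nonempty, Metric.ediam (t n) ^ s) = Metric.ediam (t n) ^ s := by
    intro n
    rcases (t n).eq_empty_or_nonempty with h | h
    · simp [h, hs]
    · simp [h]
  simp only [hterm] at hsum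
  obtain ⟨e, he0, hesum⟩ := ENNReal.exists_pos_sum_of_countable hε'.ne' ℕ
  let S : ℕ → ℝ≥0∞ := fun k => Metric.ediam (t k) ^ s + e k
  have hS : ∑' k, S k ≤ ENNReal.ofReal ε := by
    rw [ENNReal.tsum_add]
    refine (add_le_add hsum.le hesum.le).trans ?_
    rw [← ENNReal.ofReal_add (by linarith) (by linarith), add_halves]
  have hStop : ∀ k, S k ≠ ⊤ := fun k =>
    ne_top_of_le_ne_top ENNReal.ofReal_ne_top ((ENNReal.le_tsum k).trans hS)
  have hSpos : ∀ k, 0 < (S k).toReal := fun k => ENNReal.toReal_pos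
    (by have := he0 k; simp only [S]; positivity) (hStop k)
  refine ⟨t, fun k => (S k).toReal ^ s⁻¹, hcov, fun k => Real.rpow_pos_of_pos (hSpos k) _, ?_, ?_⟩
  · intro k x hx y hy
    have h1 : edist x y < S k ^ s⁻¹ := by
      refine (Metric.edist_le_ediam_of_mem hx hy).trans_lt ?_
      rw [ENNReal.lt_rpow_inv_iff hs]
      refine ENNReal.lt_add_right (ne_top_of_le_ne_top (hStop k) le_self_add) ?_
      exact_mod_cast (he0 k).ne'
    rw [edist_dist, ENNReal.ofReal_lt_iff_lt_toReal dist_nonneg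
      (ENNReal.rpow_ne_top_of_nonneg (inv_nonneg.2 hs.le) (hStop k)), ← ENNReal.toReal_rpow] at h1
    exact h1
  · intro F
    calc ∑ k ∈ F, ((S k).toReal ^ s⁻¹) ^ s = ∑ k ∈ F, (S k).toReal :=
          Finset.sum_congr rfl fun k _ => Real.rpow_inv_rpow (hSpos k).le hs.ne'
      _ = (∑ k ∈ F, S k).toReal := (ENNReal.toReal_sum fun k _ => hStop k).symm
      _ ≤ ε := ENNReal.toReal_le_of_le_ofReal hε.le ((ENNReal.sum_le_tsum F).trans hS)

lemma eq_of_abs_value_sub_lt (hq : 1 < q) (hqM : q ≤ (M : ℝ) + 1) {c e : ℕ → Fin (M + 1)}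
    (hc : c ∈ weakSeq M q) (he : e ∈ weakSeq M q) {m : ℕ}
    (h : |value M q c - value M q e| < ((M : ℝ) / (q - 1) - 1) / q ^ m) :
    ∀ j < m, c j = e j := by
  intro j
  induction j using Nat.strong_induction_on with
  | _ j ih =>
    intro hj
    by_contra hne
    have h1 := le_abs_value_sub_value hq hc he (fun i hi => ih i hi (hi.trans hj)) hne
    have hκ : 0 ≤ (M : ℝ) / (q - 1) - 1 := by
      rw [sub_nonneg, le_div_iff₀ (by linarith)]
      linarith
    have h2 : ((M : ℝ) / (q - 1) - 1) / q ^ m ≤ ((M : ℝ) / (q - 1) - 1) / q ^ (j + 1) :=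
      div_le_div_of_nonneg_left hκ (pow_pos (by linarith) _)
        (pow_le_pow_right₀ hq.le (Nat.succ_le_of_lt hj))
    linarith

/-- For `q < M + 1`, covering the values of the weakly univoque sequences by small intervals
amounts to covering the sequences by cylinders, of which finitely many suffice by compactness. -/
lemma exists_cylinder_cover (hq : 1 < q) (hqM : q < (M : ℝ) + 1) {s : ℝ} (hs : 0 < s)
    (h : MeasureTheory.Measure.hausdorffMeasure s (value M q '' weakSeq M q) = 0) :
    ∃ (F : Finset ℕ) (w : ℕ → ℕ → Fin (M + 1)) (len : ℕ → ℕ), (∀ k ∈ F, 0 < len k) ∧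
      (∀ c ∈ weakSeq M q, ∃ k ∈ F, ∀ j < len k, c j = w k j) ∧
      ∑ k ∈ F, ((q ^ s) ^ len k)⁻¹ ≤ 1 := by
  have h0 : 0 < q := by linarith
  obtain ⟨κ, hκ⟩ : ∃ κ, κ = (M : ℝ) / (q - 1) - 1 := ⟨_, rfl⟩
  have hκ0 : 0 < κ := by
    rw [hκ, sub_pos, lt_div_iff₀ (by linarith)]
    linarith
  have hε : 0 < (κ / q) ^ s := Real.rpow_pos_of_pos (by positivity) s
  obtain ⟨t, η, hcov, hη, hdist, hsum⟩ :=
    exists_cover_of_hausdorffMeasure_eq_zero hs h (half_pos hε)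
  have hlt : ∀ k, η k < κ / q := fun k => by
    have := hsum {k}
    rw [Finset.sum_singleton] at this
    exact (Real.rpow_lt_rpow_iff (hη k).le (by positivity) hs).1 (by linarith)
  have hlen : ∀ k, ∃ m, 0 < m ∧ η k ≤ κ / q ^ m ∧ (q ^ m)⁻¹ ≤ η k / (κ / q) := by
    intro k
    have hk := hη k
    have h1 : q < κ / η k := by
      have := hlt k
      rw [lt_div_iff₀ h0] at this
      rw [lt_div_iff₀ hk]
      linarith
    obtain ⟨m, hm1, hm2⟩ := exists_nat_pow_near (hq.le.trans h1.le) hq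
    refine ⟨m, Nat.pos_of_ne_zero ?_, ?_, ?_⟩
    · rintro rfl
      rw [zero_add, pow_one] at hm2
      exact lt_asymm h1 hm2
    · rw [le_div_iff₀ (by positivity)]
      rw [le_div_iff₀ hk] at hm1
      linarith
    · rw [div_lt_iff₀ hk, pow_succ] at hm2
      rw [div_div_eq_mul_div, le_div_iff₀ hκ0, inv_mul_le_iff₀ (by positivity)]
      linarith
  choose len hlen0 hlen1 hlen2 using hlen
  have hw : ∀ k, ∃ w : ℕ → Fin (M + 1), ∀ c ∈ weakSeq M q, value M q c ∈ t k →
      ∀ j < len k, c j = w j := by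
    intro k
    by_cases hk : ∃ e ∈ weakSeq M q, value M q e ∈ t k
    · obtain ⟨e, he, het⟩ := hk
      refine ⟨e, fun c hc hct => eq_of_abs_value_sub_lt hq hqM.le hc he ?_⟩
      rw [← hκ, ← Real.dist_eq]
      exact (hdist k _ hct _ het).trans_le (hlen1 k)
    · exact ⟨fun _ => 0, fun c hc hct => absurd ⟨c, hc, hct⟩ hk⟩
  choose w hw using hw
  have hopen : ∀ k, IsOpen {c : ℕ → Fin (M + 1) | ∀ j < len k, c j = w k j} := by
    intro k
    simp only [Set.ofPred_forall]
    exact (Set.finite_lt_nat (len k)).isOpen_biInter fun j _ =>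
      (isOpen_discrete ({w k j} : Set (Fin (M + 1)))).preimage
        (continuous_apply j : Continuous fun c : ℕ → Fin (M + 1) => c j)
  obtain ⟨F, hF⟩ := (isCompact_weakSeq (M := M) hq).elim_finite_subcover _ hopen fun c hc => by
    obtain ⟨k, hk⟩ := Set.mem_iUnion.1 (hcov (Set.mem_image_of_mem _ hc))
    exact Set.mem_iUnion.2 ⟨k, hw k c hc hk⟩
  refine ⟨F, w, len, fun k _ => hlen0 k, fun c hc => ?_, ?_⟩
  · obtain ⟨k, hk, hck⟩ := Set.mem_iUnion₂.1 (hF hc)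
    exact ⟨k, hk, hck⟩
  · calc ∑ k ∈ F, ((q ^ s) ^ len k)⁻¹ ≤ ∑ k ∈ F, η k ^ s / (κ / q) ^ s := by
          refine Finset.sum_le_sum fun k _ => ?_
          rw [← Real.div_rpow (hη k).le (by positivity), ← Real.rpow_mul_natCast h0.le, mul_comm s,
            Real.rpow_natCast_mul h0.le, ← Real.inv_rpow (by positivity)]
          exact Real.rpow_le_rpow (by positivity) (hlen2 k) hs.le
      _ = (∑ k ∈ F, η k ^ s) / (κ / q) ^ s := (Finset.sum_div _ _ _).symm
      _ ≤ 1 := by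
          rw [div_le_one hε]
          linarith [hsum F]

lemma logb_pos (hM : 1 ≤ M) (hq : 1 < q) : 0 < Real.logb ((M : ℝ) + 1) q := by
  have : (1 : ℝ) ≤ M := by exact_mod_cast hM
  exact Real.logb_pos (by linarith) hq

lemma entropy_div_logb_le_of_dimH_lt (hM : 1 ≤ M) (hq : 1 < q) (hqM : q < (M : ℝ) + 1) {s : ℝ≥0}
    (h : dimH (univoqueSet M q) < s) :
    entropy (univoqueSeq M q) / Real.logb ((M : ℝ) + 1) q ≤ s := by
  have h0 : 0 < q := by linarith
  have hs : (0 : ℝ) < s := by exact_mod_cast pos_of_gt h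
  rw [dimH_univoqueSet hq hqM.le] at h
  obtain ⟨F, w, len, hlen, hcov, hsum⟩ :=
    exists_cylinder_cover hq hqM hs (hausdorffMeasure_of_dimH_lt h)
  obtain ⟨K, hK, hle⟩ := exists_ncard_prefixes_le (fun c hc => shift_mem_weakSeq hc) F w len hlen
    hcov (Real.one_le_rpow hq.le hs.le) hsum
  rw [div_le_iff₀ (logb_pos hM hq), ← Real.logb_rpow_eq_mul_logb_of_pos h0]
  refine entropy_le_of_ncard_le hM ⟨_, const_zero_mem_univoqueSeq hq⟩
    (fun c hc => shift_mem_univoqueSeq hq hc) (Real.rpow_pos_of_pos h0 _) hK fun n => ?_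
  refine le_trans ?_ (hle n)
  exact_mod_cast Set.ncard_le_ncard (prefixes_mono (univoqueSeq_subset_weakSeq hq hqM.le) n)
    (Set.toFinite _)

/-- At `q = M + 1` every sequence is weakly univoque, so the univoque set is `[0, 1]` up to a
countable set. -/
lemma dimH_univoqueSet_of_eq (hM : 1 ≤ M) (hqM : q = (M : ℝ) + 1) :
    dimH (univoqueSet M q) = 1 := by
  have hM' : (1 : ℝ) ≤ M := by exact_mod_cast hM
  have hq : 1 < q := by linarith
  have hC : (M : ℝ) / (q - 1) = 1 := by
    rw [hqM, add_sub_cancel_right, div_self (by linarith)]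
  have himage : value M q '' weakSeq M q = Set.Icc 0 1 := by
    ext x
    constructor
    · rintro ⟨c, -, rfl⟩
      exact ⟨value_nonneg hq c, hC ▸ value_le hq c⟩
    · intro hx
      rw [← hC] at hx
      obtain ⟨c, hc⟩ := exists_value_eq hq hqM.le hx
      refine ⟨c, fun n => ⟨fun _ => hC ▸ value_le hq _, fun _ => ?_⟩, hc⟩
      rw [hC, sub_self]
      exact value_nonneg hq _
  rw [dimH_univoqueSet hq hqM.le, himage, Real.dimH_of_nonempty_interior]
  · simp
  · rw [interior_Icc]
    exact Set.nonempty_Ioo.2 one_pos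

lemma ofReal_entropy_div_logb_le_dimH (hM : 1 ≤ M) (hq : 1 < q) (hqM : q ≤ (M : ℝ) + 1) :
    ENNReal.ofReal (entropy (univoqueSeq M q) / Real.logb ((M : ℝ) + 1) q) ≤
      dimH (univoqueSet M q) := by
  rcases hqM.lt_or_eq with h | h
  · refine le_of_forall_gt_imp_ge_of_dense fun b hb => ?_
    obtain ⟨s, hs1, hs2⟩ := ENNReal.lt_iff_exists_nnreal_btwn.1 hb
    refine le_trans ?_ hs2.le
    rw [ENNReal.ofReal_le_iff_le_toReal ENNReal.coe_ne_top, ENNReal.coe_toReal]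
    exact entropy_div_logb_le_of_dimH_lt hM hq h hs1
  · have hM' : (1 : ℝ) ≤ M := by exact_mod_cast hM
    rw [dimH_univoqueSet_of_eq hM h, ENNReal.ofReal_le_one, div_le_one (logb_pos hM hq), h]
    refine entropy_le_of_ncard_le hM ⟨_, const_zero_mem_univoqueSeq (h ▸ hq)⟩
      (fun c hc => shift_mem_univoqueSeq (h ▸ hq) hc) (by linarith) one_pos fun n => ?_
    rw [one_mul]
    exact_mod_cast ncard_prefixes_le_pow _ n

/-! ### Box dimensions -/

lemma exists_isCover_encard_eq_coverNum (X : Set ℝ) (δ : ℝ) :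
    ∃ C : Set ℝ, Metric.IsCover (δ / 2).toNNReal X C ∧ C.encard = coverNum X δ := by
  have : Nonempty {C : Set ℝ // Metric.IsCover (δ / 2).toNNReal X C} := ⟨⟨X, .rfl⟩⟩
  obtain ⟨C, hC⟩ := ENat.exists_eq_iInf
    fun C : {C : Set ℝ // Metric.IsCover (δ / 2).toNNReal X C} => (C : Set ℝ).encard
  refine ⟨C, C.2, ?_⟩
  rw [hC, coverNum, Metric.externalCoveringNumber, iInf_subtype']

/-- If the lower box dimension is below `s`, there are covers by `N` intervals of length `δ` with
`N * δ ^ s ≤ 1` and `δ` arbitrarily small, so that the `s`-dimensional Hausdorff measure is at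
most `1`. Nonemptiness matters: the lower box dimension of the empty set is `⊥`. -/
lemma dimH_le_lowerBoxDim {X : Set ℝ} (hX : X.Nonempty) :
    ((dimH X : ℝ≥0∞) : EReal) ≤ lowerBoxDim X := by
  by_contra! hlt
  obtain ⟨s, hs1, hs2⟩ := EReal.lt_iff_exists_real_btwn.1 hlt
  have hδ01 : ∀ᶠ δ : ℝ in 𝓝[>] 0, 0 < δ ∧ δ < 1 := Ioo_mem_nhdsGT one_pos
  have hs0 : 0 ≤ s := by
    rw [← EReal.coe_nonneg]
    refine le_trans ?_ hs1.le
    refine le_liminf_of_le (by isBoundedDefault) ?_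
    filter_upwards [hδ01] with δ hδ
    have h1 : (0 : EReal) < ((-Real.log δ : ℝ) : EReal) :=
      EReal.coe_pos.2 (neg_pos.2 (Real.log_neg hδ.1 hδ.2))
    rw [boxRatio, EReal.le_div_iff_mul_le h1 (EReal.coe_ne_top _), zero_mul,
      ENNReal.zero_le_log_iff]
    have : 1 ≤ coverNum X δ :=
      Order.one_le_iff_pos.2 (Metric.externalCoveringNumber_pos_iff.2 hX)
    exact_mod_cast this
  obtain ⟨δ, hδlim, hδ⟩ := exists_seq_forall_of_frequently
    ((frequently_lt_of_liminf_lt (by isBoundedDefault) hs1).and_eventually hδ01)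
  choose C hC hCcard using fun n => exists_isCover_encard_eq_coverNum X (δ n)
  have hN : ∀ n, ((C n).encard : ℝ≥0∞) < ENNReal.ofReal (δ n ^ (-s)) := by
    intro n
    obtain ⟨h, h0, h1⟩ := hδ n
    have hlog : (0 : EReal) < ((-Real.log (δ n) : ℝ) : EReal) :=
      EReal.coe_pos.2 (neg_pos.2 (Real.log_neg h0 h1))
    rw [boxRatio, EReal.div_lt_iff hlog (EReal.coe_ne_top _), ← EReal.coe_mul] at h
    rw [hCcard, ← ENNReal.log_lt_log_iff, ENNReal.log_ofReal_of_pos (Real.rpow_pos_of_pos h0 _),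
      Real.log_rpow h0]
    convert h using 2
    ring
  have hfin : ∀ n, (C n).Finite := fun n => by
    rw [← Set.encard_lt_top_iff]
    have := (hN n).trans ENNReal.ofReal_lt_top
    exact_mod_cast this
  have : ∀ n, Fintype (C n) := fun n => (hfin n).fintype
  have hdiam : ∀ n (i : C n),
      Metric.ediam (Metric.closedBall (i : ℝ) (δ n / 2)) ≤ ENNReal.ofReal (δ n) := fun n i => by
    rw [Real.closedBall_eq_Icc, Real.ediam_Icc]
    exact ENNReal.ofReal_le_ofReal (by linarith)
  have hr : Tendsto (fun n => ENNReal.ofReal (δ n)) atTop (𝓝 0) := by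
    rw [← ENNReal.ofReal_zero]
    exact ENNReal.tendsto_ofReal (hδlim.mono_right nhdsWithin_le_nhds)
  have hmeas := MeasureTheory.Measure.hausdorffMeasure_le_liminf_sum s X
    (fun n => ENNReal.ofReal (δ n)) hr
    (fun n (i : C n) => Metric.closedBall (i : ℝ) (δ n / 2)) (Eventually.of_forall hdiam)
    (Eventually.of_forall fun n => by
      have := (hC n).subset_iUnion_closedBall
      rwa [Set.biUnion_eq_iUnion, Real.coe_toNNReal _ (half_pos (hδ n).2.1).le] at this)
  have hle : MeasureTheory.Measure.hausdorffMeasure s X ≤ 1 := by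
    refine hmeas.trans (liminf_le_of_le (by isBoundedDefault) fun b hb => ?_)
    obtain ⟨n, hn⟩ := hb.exists
    refine hn.trans ?_
    have h0 := (hδ n).2.1
    calc ∑ i : C n, Metric.ediam (Metric.closedBall (i : ℝ) (δ n / 2)) ^ s
        ≤ ∑ _i : C n, ENNReal.ofReal (δ n ^ s) := by
          refine Finset.sum_le_sum fun i _ => ?_
          rw [← ENNReal.ofReal_rpow_of_pos h0]
          exact ENNReal.rpow_le_rpow (hdiam n i) hs0
      _ = ((C n).encard : ℝ≥0∞) * ENNReal.ofReal (δ n ^ s) := by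
          rw [Finset.sum_const, nsmul_eq_mul, Finset.card_univ, ← (hfin n).cast_ncard_eq,
            ← Nat.card_eq_fintype_card, Nat.card_coe_set_eq]
          rfl
      _ ≤ ENNReal.ofReal (δ n ^ (-s)) * ENNReal.ofReal (δ n ^ s) := by
          gcongr
          exact (hN n).le
      _ = 1 := by
          rw [← ENNReal.ofReal_mul (Real.rpow_nonneg h0.le _), ← Real.rpow_add h0,
            neg_add_cancel, Real.rpow_zero, ENNReal.ofReal_one]
  lift s to ℝ≥0 using hs0
  have hdim : dimH X ≤ s :=
    dimH_le_of_hausdorffMeasure_ne_top (ne_top_of_le_ne_top ENNReal.one_ne_top hle)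
  refine absurd hs2 (not_lt.2 ?_)
  exact (EReal.coe_ennreal_le_coe_ennreal_iff.2 hdim).trans_eq
    (EReal.coe_nnreal_eq_coe_real s)

lemma lowerBoxDim_le_upperBoxDim (X : Set ℝ) : lowerBoxDim X ≤ upperBoxDim X :=
  liminf_le_limsup (by isBoundedDefault) (by isBoundedDefault)

lemma upperBoxDim_le_of_coverNum_le {X : Set ℝ} {K t : ℝ} (hK : 0 < K)
    (h : ∀ᶠ δ in 𝓝[>] (0 : ℝ), (coverNum X δ : ℝ≥0∞) ≤ ENNReal.ofReal (K * δ ^ (-t))) :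
    upperBoxDim X ≤ t := by
  have hlim : Tendsto (fun δ : ℝ => ((Real.log K / (-Real.log δ) + t : ℝ) : EReal)) (𝓝[>] 0)
      (𝓝 (t : EReal)) := by
    rw [EReal.tendsto_coe]
    have h1 : Tendsto (fun δ : ℝ => -Real.log δ) (𝓝[>] 0) atTop :=
      tendsto_neg_atBot_atTop.comp Real.tendsto_log_nhdsGT_zero
    simpa using (h1.const_div_atTop (Real.log K)).add_const t
  rw [← hlim.limsup_eq]
  refine limsup_le_limsup ?_ (by isBoundedDefault) (by isBoundedDefault)
  filter_upwards [h, Ioo_mem_nhdsGT one_pos] with δ hδ hδ01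
  have hlog : 0 < -Real.log δ := neg_pos.2 (Real.log_neg hδ01.1 hδ01.2)
  rw [boxRatio, EReal.div_le_iff_le_mul (EReal.coe_pos.2 hlog) (EReal.coe_ne_top _),
    ← EReal.coe_mul]
  refine (ENNReal.log_le_log hδ).trans_eq ?_
  have hpow : 0 < δ ^ (-t) := Real.rpow_pos_of_pos hδ01.1 _
  rw [ENNReal.log_ofReal_of_pos (mul_pos hK hpow), Real.log_mul hK.ne' hpow.ne',
    Real.log_rpow hδ01.1, mul_add, mul_div_cancel₀ _ hlog.ne']
  congr 1
  ring

/-- The cylinders of length `n` have diameter at most `M / (q - 1) / q ^ n`, so one interval per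
word of length `n` suffices at that scale. -/
lemma coverNum_univoqueSet_le (hq : 1 < q) {n : ℕ} {δ : ℝ}
    (hδ : (M : ℝ) / (q - 1) / q ^ n ≤ δ / 2) :
    coverNum (univoqueSet M q) δ ≤ ((prefixes (univoqueSeq M q) n).ncard : ℕ∞) := by
  have h0 : 0 < q := by linarith
  choose! g hgX hg using fun (p : Fin n → Fin (M + 1)) (hp : p ∈ prefixes (univoqueSeq M q) n) =>
    hp
  have hcover : Metric.IsCover (δ / 2).toNNReal (univoqueSet M q)
      ((fun p => value M q (g p)) '' prefixes (univoqueSeq M q) n) := by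
    rw [Metric.isCover_iff_subset_iUnion_closedBall]
    intro x hx
    obtain ⟨c, hcx, -⟩ := hx.2
    have hp : (fun i : Fin n => c i) ∈ prefixes (univoqueSeq M q) n :=
      ⟨c, show value M q c ∈ _ from hcx ▸ hx, rfl⟩
    refine Set.mem_biUnion (Set.mem_image_of_mem _ hp) ?_
    have heq : ∀ i < n, c i = g (fun i : Fin n => c i) i := fun i hi =>
      (congrFun (hg _ hp) ⟨i, hi⟩).symm
    generalize g (fun i : Fin n => c i) = e at heq
    rw [Metric.mem_closedBall, Real.dist_eq, ← hcx]
    refine (le_trans ?_ hδ).trans (Real.le_coe_toNNReal _)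
    rw [value_split hq n c, value_split hq n e,
      Finset.sum_congr rfl fun i hi => by rw [heq i (Finset.mem_range.1 hi)],
      add_sub_add_left_eq_sub, ← sub_div, abs_div, abs_of_pos (pow_pos h0 n)]
    refine div_le_div_of_nonneg_right ?_ (pow_pos h0 n).le
    rw [abs_le]
    have hc0 := value_nonneg hq (shift n c)
    have hc1 := value_le hq (shift n c)
    have he0 := value_nonneg hq (shift n e)
    have he1 := value_le hq (shift n e)
    constructor <;> linarith
  refine hcover.externalCoveringNumber_le_encard.trans ((Set.encard_image_le _ _).trans_eq ?_)
  exact (Set.toFinite _).cast_ncard_eq.symm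

lemma upperBoxDim_univoqueSet_le (hM : 1 ≤ M) (hq : 1 < q) :
    upperBoxDim (univoqueSet M q) ≤
      ((entropy (univoqueSeq M q) / Real.logb ((M : ℝ) + 1) q : ℝ) : EReal) := by
  have h0 : 0 < q := by linarith
  have hM' : (1 : ℝ) ≤ M := by exact_mod_cast hM
  have hne : (univoqueSeq M q).Nonempty := ⟨_, const_zero_mem_univoqueSeq hq⟩
  have hinv : ∀ c ∈ univoqueSeq M q, ∀ k, shift k c ∈ univoqueSeq M q :=
    fun c hc => shift_mem_univoqueSeq hq hc
  have hent := tendsto_entropySeq hne hinv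
  have hent0 : 0 ≤ entropy (univoqueSeq M q) := by
    refine ge_of_tendsto' hent fun n => div_nonneg ?_ (Nat.cast_nonneg n)
    rw [subwords_eq_prefixes hinv]
    exact Real.logb_nonneg (by linarith) (by exact_mod_cast one_le_ncard_prefixes hne n)
  have hlogb := logb_pos hM hq
  refine EReal.le_of_forall_lt_iff_le.1 fun t ht => ?_
  rw [EReal.coe_lt_coe_iff] at ht
  have ht0 : 0 < t := (div_nonneg hent0 hlogb.le).trans_lt ht
  rw [div_lt_iff₀ hlogb] at ht
  obtain ⟨n₀, hn₀⟩ := eventually_atTop.1 ((hent.eventually_lt_const ht).and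
    (eventually_gt_atTop 0))
  have hcount : ∀ n ≥ n₀, ((prefixes (univoqueSeq M q) n).ncard : ℝ) ≤ (q ^ n) ^ t := by
    intro n hn
    obtain ⟨h1, h2⟩ := hn₀ n hn
    have h2' : (0 : ℝ) < n := by exact_mod_cast h2
    have hpos : (0 : ℝ) < (prefixes (univoqueSeq M q) n).ncard := by
      exact_mod_cast one_le_ncard_prefixes hne n
    rw [entropySeq, subwords_eq_prefixes hinv, div_lt_iff₀ h2'] at h1
    refine ((Real.logb_lt_logb_iff (b := (M : ℝ) + 1) (by linarith) hpos
      (by positivity)).1 ?_).le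
    rw [Real.logb_rpow_eq_mul_logb_of_pos (by positivity), Real.logb_pow]
    linarith
  obtain ⟨C, hC⟩ : ∃ C, C = (M : ℝ) / (q - 1) := ⟨_, rfl⟩
  have hC0 : 0 < C := by
    rw [hC]
    exact div_pos (by linarith) (by linarith)
  refine upperBoxDim_le_of_coverNum_le (K := (2 * C * q) ^ t) (by positivity) ?_
  have hsmall : (0 : ℝ) < min (2 * C) (2 * C / q ^ n₀) := by positivity
  filter_upwards [Ioo_mem_nhdsGT hsmall] with δ hδ
  have hδ0 : 0 < δ := hδ.1
  have hδ1 : δ < 2 * C := hδ.2.trans_le (min_le_left _ _)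
  have hδ2 : δ < 2 * C / q ^ n₀ := hδ.2.trans_le (min_le_right _ _)
  -- the cylinder length is chosen so that `2 * C / q ^ (m + 1) < δ ≤ 2 * C / q ^ m`
  obtain ⟨m, hm1, hm2⟩ := exists_nat_pow_near (x := 2 * C / δ) (y := q)
    ((one_le_div hδ0).2 hδ1.le) hq
  have hm : n₀ ≤ m + 1 := by
    rw [lt_div_iff₀ (by positivity), mul_comm, ← lt_div_iff₀ hδ0] at hδ2
    exact ((pow_lt_pow_iff_right₀ hq).1 (hδ2.trans hm2)).le
  have hcov : coverNum (univoqueSet M q) δ ≤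
      ((prefixes (univoqueSeq M q) (m + 1)).ncard : ℕ∞) := by
    refine coverNum_univoqueSet_le hq ?_
    rw [← hC, div_le_iff₀ (by positivity)]
    rw [div_lt_iff₀ hδ0] at hm2
    linarith
  calc (coverNum (univoqueSet M q) δ : ℝ≥0∞)
      ≤ ((prefixes (univoqueSeq M q) (m + 1)).ncard : ℝ≥0∞) := by exact_mod_cast hcov
    _ = ENNReal.ofReal ((prefixes (univoqueSeq M q) (m + 1)).ncard : ℝ) :=
        (ENNReal.ofReal_natCast _).symm
    _ ≤ ENNReal.ofReal ((2 * C * q) ^ t * δ ^ (-t)) := by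
        refine ENNReal.ofReal_le_ofReal ((hcount _ hm).trans ?_)
        rw [Real.rpow_neg hδ0.le, ← div_eq_mul_inv, ← Real.div_rpow (by positivity) hδ0.le]
        refine Real.rpow_le_rpow (by positivity) ?_ ht0.le
        rw [pow_succ, mul_div_right_comm]
        exact mul_le_mul_of_nonneg_right hm1 h0.le

end Univoque

theorem theorem4 (M : ℕ) (hM : 1 ≤ M) (q : ℝ) (hq : 1 < q) (hqM : q ≤ (M : ℝ) + 1) :
    Univoque.lowerBoxDim (Univoque.univoqueSet M q) =
        ((dimH (Univoque.univoqueSet M q) : ENNReal) : EReal) ∧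
      Univoque.upperBoxDim (Univoque.univoqueSet M q) =
        ((dimH (Univoque.univoqueSet M q) : ENNReal) : EReal) ∧
      Tendsto (Univoque.entropySeq (Univoque.univoqueSeq M q)) atTop
        (𝓝 (Univoque.entropy (Univoque.univoqueSeq M q))) ∧
      ((dimH (Univoque.univoqueSet M q) : ENNReal) : EReal) =
        ((Univoque.entropy (Univoque.univoqueSeq M q) / Real.logb ((M : ℝ) + 1) q : ℝ) :
          EReal) := by
  open Univoque in
  have hzero := const_zero_mem_univoqueSeq (M := M) hq
  have h1 := dimH_le_lowerBoxDim (X := univoqueSet M q) ⟨_, hzero⟩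
  have h2 := lowerBoxDim_le_upperBoxDim (univoqueSet M q)
  have h3 := upperBoxDim_univoqueSet_le hM hq
  have h4 : ((entropy (univoqueSeq M q) / Real.logb ((M : ℝ) + 1) q : ℝ) : EReal) ≤
      ((dimH (univoqueSet M q) : ℝ≥0∞) : EReal) := by
    refine le_trans ?_ (EReal.coe_ennreal_le_coe_ennreal_iff.2
      (ofReal_entropy_div_logb_le_dimH hM hq hqM))
    rw [EReal.coe_ennreal_ofReal, EReal.coe_le_coe_iff]
    exact le_max_left _ _
  exact ⟨le_antisymm (h2.trans (h3.trans h4)) h1, le_antisymm (h3.trans h4) (h1.trans h2),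
    tendsto_entropySeq ⟨_, hzero⟩ fun c hc => shift_mem_univoqueSeq hq hc,
    le_antisymm (h1.trans (h2.trans h3)) h4⟩
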